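/- A commutative BCK-algebra (cBCK-algebra) is an algebra $(A,\ominus,0)$ of type $(2,0)$ such that for all $x,y,z\in A$: $((x\ominus y)\ominus(x\ominus z))\ominus(z\ominus y)=0$; $x\ominus 0=x$; $0\ominus x=0$; if $x\ominus y=0$ and $y\ominus x=0$ then $x=y$; and $x\ominus(x\ominus y)=y\ominus(y\ominus x)$. A variety of cBCK-algebras is a class of cBCK-algebras closed under homomorphic images, subalgebras (up to isomorphism) and arbitrary direct products; it is finitely generated if it is the smallest variety containing some finite set of finite cBCK-algebras. A variety $\mathcal W$ of cBCK-algebras is a cover of $\mathcal V$ if $\mathcal V\subsetneq\mathcal W$ and there is no variety $\mathcal K$ of cBCK-algebras with $\mathcal V\subsetneq\mathcal K\subsetneq\mathcal W$. Corollary. Let $\mathcal V$ be a finitely generated variety of cBCK-algebras. Then every cover $\mathcal W$ of $\mathcal V$ among the varieties of cBCK-algebras is finitely generated. -/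

import Mathlib

universe u

/-- A BCK-algebra: an algebra `(A, ⊖, 0)` of type `(2, 0)` satisfying three identities and one
quasi-identity. -/
class BCKAlgebra (A : Type u) extends Zero A where
  /-- The binary operation `x ⊖ y`. -/
  ominus : A → A → A
  bck_one : ∀ x y z : A, ominus (ominus (ominus x y) (ominus x z)) (ominus z y) = 0
  ominus_zero : ∀ x : A, ominus x 0 = x
  zero_ominus : ∀ x : A, ominus 0 x = 0
  eq_of_ominus : ∀ x y : A, ominus x y = 0 → ominus y x = 0 → x = y

infixl:65 " ⊖ " => BCKAlgebra.ominus

/-- A commutative BCK-algebra (cBCK-algebra). -/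
class CBCKAlgebra (A : Type u) extends BCKAlgebra A where
  comm : ∀ x y : A, x ⊖ (x ⊖ y) = y ⊖ (y ⊖ x)

/-- The direct product of a family of cBCK-algebras, with pointwise operations. -/
instance CBCKAlgebra.pi {I : Type u} (A : I → Type u) [∀ i, CBCKAlgebra (A i)] :
    CBCKAlgebra (∀ i, A i) where
  zero := fun _ => 0
  ominus x y := fun i => x i ⊖ y i
  bck_one x y z := funext fun i => BCKAlgebra.bck_one (x i) (y i) (z i)
  ominus_zero x := funext fun i => BCKAlgebra.ominus_zero (x i)
  zero_ominus x := funext fun i => BCKAlgebra.zero_ominus (x i)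
  eq_of_ominus x y h k :=
    funext fun i => BCKAlgebra.eq_of_ominus (x i) (y i) (congrFun h i) (congrFun k i)
  comm x y := funext fun i => CBCKAlgebra.comm (x i) (y i)

/-- Homomorphisms of algebras of type `(2, 0)`. -/
structure IsCBCKHom {A B : Type u} [CBCKAlgebra A] [CBCKAlgebra B] (f : A → B) : Prop where
  map_zero : f 0 = 0
  map_ominus : ∀ x y : A, f (x ⊖ y) = f x ⊖ f y

/-- A variety of cBCK-algebras: a class of cBCK-algebras closed under homomorphic images,
(isomorphic copies of) subalgebras, and arbitrary direct products. Since cBCK-algebras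
themselves form an equational class, every homomorphic image of one is again a cBCK-algebra. -/
structure CBCKVariety where
  /-- Membership of a cBCK-algebra in the class. -/
  Mem : (A : Type u) → [CBCKAlgebra A] → Prop
  image_mem : ∀ {A B : Type u} [CBCKAlgebra A] [CBCKAlgebra B] (f : A → B),
    IsCBCKHom f → Function.Surjective f → Mem A → Mem B
  subalgebra_mem : ∀ {A B : Type u} [CBCKAlgebra A] [CBCKAlgebra B] (f : A → B),
    IsCBCKHom f → Function.Injective f → Mem B → Mem A
  pi_mem : ∀ {I : Type u} (A : I → Type u) [∀ i, CBCKAlgebra (A i)],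
    (∀ i, Mem (A i)) → Mem (∀ i, A i)

namespace CBCKVariety

/-- Varieties are ordered by inclusion of classes. -/
instance : PartialOrder CBCKVariety.{u} where
  le V W := ∀ (A : Type u) [CBCKAlgebra A], V.Mem A → W.Mem A
  le_refl _ _ _ h := h
  le_trans _ _ _ h k A _ hA := k A (h A hA)
  le_antisymm V W h k := by
    obtain ⟨M, _, _, _⟩ := V
    obtain ⟨N, _, _, _⟩ := W
    have hMN : @M = @N := by
      funext A inst
      exact propext ⟨h A, k A⟩
    subst hMN
    rfl

/-- The variety generated by a family of cBCK-algebras: the intersection of all varieties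
containing every member of the family. -/
def generatedBy {ι : Type*} (G : ι → Type u) [∀ i, CBCKAlgebra (G i)] : CBCKVariety.{u} where
  Mem A _ := ∀ V : CBCKVariety.{u}, (∀ i, V.Mem (G i)) → V.Mem A
  image_mem f hf hs hA V hV := V.image_mem f hf hs (hA V hV)
  subalgebra_mem f hf hi hB V hV := V.subalgebra_mem f hf hi (hB V hV)
  pi_mem A _ hA V hV := V.pi_mem A fun i => hA i V hV

/-- A variety is finitely generated if it is generated by finitely many finite algebras. -/
def FinitelyGenerated (V : CBCKVariety.{u}) : Prop :=
  ∃ (n : ℕ) (G : Fin n → Type u) (_ : ∀ i, CBCKAlgebra (G i)),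
    (∀ i, Finite (G i)) ∧ V = generatedBy G

end CBCKVariety

/-! Write `x ≤ y` for `x ⊖ y = 0`; then `x ⊖ (x ⊖ y)` is the meet of `x` and `y`. A finitely
generated `V` satisfies some law `stable N`. Suppose all finite members of `W` lie in `V`. If a
prime member of `W` violated `stable (N + 1)`, it would contain a finite chain of multiples `0, y,
…, (N + 1)y` (`exists_multiples`), which lies in `V` but violates `stable N`. So `W` satisfies
`stable (N + 1)`, which makes all intervals `[0, x]` in its prime members finite
(`finite_interval`). Such members are locally finite, hence in `V`, and `W ≤ V` by `le_of_prime`.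
Thus a cover `W` contains a finite algebra outside `V`; adding it to the generators of `V` must give
all of `W`. -/

namespace CBCKAlgebra

/-! ### Arithmetic of differences, meets and iterated differences -/

section Basic

variable {A : Type u} [CBCKAlgebra A]

attribute [simp] BCKAlgebra.ominus_zero BCKAlgebra.zero_ominus

@[simp] theorem ominus_self (x : A) : x ⊖ x = 0 := by
  simpa using BCKAlgebra.bck_one x 0 0

theorem ominus_antisymm {x y : A} (h : x ⊖ y = 0) (k : y ⊖ x = 0) : x = y :=
  BCKAlgebra.eq_of_ominus x y h k

theorem ominus_trans {x y z : A} (h : x ⊖ y = 0) (k : y ⊖ z = 0) : x ⊖ z = 0 := by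
  simpa [h, k] using BCKAlgebra.bck_one x z y

theorem meet_ominus_right (x y : A) : (x ⊖ (x ⊖ y)) ⊖ y = 0 := by
  simpa using BCKAlgebra.bck_one x 0 y

theorem ominus_anti (x : A) {y z : A} (h : y ⊖ z = 0) : (x ⊖ z) ⊖ (x ⊖ y) = 0 := by
  simpa [h] using BCKAlgebra.bck_one x z y

theorem ominus_mono {x y : A} (h : x ⊖ y = 0) (z : A) : (x ⊖ z) ⊖ (y ⊖ z) = 0 := by
  simpa [h] using BCKAlgebra.bck_one x z y

theorem ominus_right_comm (x y z : A) : (x ⊖ y) ⊖ z = (x ⊖ z) ⊖ y := by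
  have key : ∀ y z : A, ((x ⊖ y) ⊖ z) ⊖ ((x ⊖ z) ⊖ y) = 0 := fun y z =>
    ominus_trans (ominus_anti _ (meet_ominus_right x z)) (BCKAlgebra.bck_one x y (x ⊖ z))
  exact ominus_antisymm (key y z) (key z y)

@[simp] theorem ominus_ominus_left (x y : A) : (x ⊖ y) ⊖ x = 0 := by
  rw [ominus_right_comm]; simp

theorem ominus_ominus_ominus_le (x y z : A) : ((x ⊖ z) ⊖ (y ⊖ z)) ⊖ (x ⊖ y) = 0 := by
  rw [ominus_right_comm]; exact BCKAlgebra.bck_one x z y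

theorem meet_eq_of_le {x y : A} (h : x ⊖ y = 0) : y ⊖ (y ⊖ x) = x := by
  rw [comm, h, BCKAlgebra.ominus_zero]

theorem le_meet {t x y : A} (hx : t ⊖ x = 0) (hy : t ⊖ y = 0) : t ⊖ (x ⊖ (x ⊖ y)) = 0 := by
  have h := ominus_anti x (ominus_anti x hy)
  rwa [meet_eq_of_le hx] at h

theorem ominus_meet (x y : A) : x ⊖ (x ⊖ (x ⊖ y)) = x ⊖ y :=
  meet_eq_of_le (ominus_ominus_left x y)

/-- Complementation in the interval `[0, x]` reverses differences. -/
theorem compl_ominus_compl {x b : A} (a : A) (hb : b ⊖ x = 0) :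
    (x ⊖ a) ⊖ (x ⊖ b) = b ⊖ a := by
  rw [ominus_right_comm, meet_eq_of_le hb]

theorem ominus_ominus_cancel {a b y : A} (hy : y ⊖ b = 0) (hb : b ⊖ a = 0) :
    (a ⊖ y) ⊖ (b ⊖ y) = a ⊖ b := by
  have h : (a ⊖ y) ⊖ (a ⊖ b) = b ⊖ y := by rw [ominus_right_comm, meet_eq_of_le hb]
  rw [← h]
  exact meet_eq_of_le (ominus_anti a hy)

/-- Elements with a common upper bound satisfy the prelinearity law. -/
theorem prelinear {x a b : A} (ha : a ⊖ x = 0) (hb : b ⊖ x = 0) :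
    (a ⊖ b) ⊖ ((a ⊖ b) ⊖ (b ⊖ a)) = 0 := by
  -- `j` is the join of `a` and `b` in `[0, x]`, obtained by complementing the meet of the
  -- complements.
  obtain ⟨j, hjb, hja, haj⟩ : ∃ j, j ⊖ b = a ⊖ b ∧ j ⊖ a = b ⊖ a ∧ a ⊖ j = 0 := by
    have key : ∀ {a b : A}, a ⊖ x = 0 → b ⊖ x = 0 →
        (x ⊖ ((x ⊖ a) ⊖ ((x ⊖ a) ⊖ (x ⊖ b)))) ⊖ a = b ⊖ a := by
      intro a b ha hb
      calc (x ⊖ ((x ⊖ a) ⊖ ((x ⊖ a) ⊖ (x ⊖ b)))) ⊖ a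
          = (x ⊖ ((x ⊖ a) ⊖ ((x ⊖ a) ⊖ (x ⊖ b)))) ⊖ (x ⊖ (x ⊖ a)) := by rw [meet_eq_of_le ha]
        _ = (x ⊖ a) ⊖ ((x ⊖ a) ⊖ ((x ⊖ a) ⊖ (x ⊖ b))) :=
            compl_ominus_compl _ (ominus_ominus_left x a)
        _ = b ⊖ a := by rw [ominus_meet, compl_ominus_compl a hb]
    refine ⟨x ⊖ ((x ⊖ a) ⊖ ((x ⊖ a) ⊖ (x ⊖ b))), ?_, key ha hb, ?_⟩
    · rw [comm (x ⊖ a) (x ⊖ b)]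
      exact key hb ha
    · have h := ominus_anti x (ominus_ominus_left (x ⊖ a) ((x ⊖ a) ⊖ (x ⊖ b)))
      rwa [meet_eq_of_le ha] at h
  have h : (a ⊖ b) ⊖ (b ⊖ a) = a ⊖ b := by
    conv_lhs => rw [← hjb, ← hja]
    rw [ominus_right_comm, meet_eq_of_le haj]
  rw [h, ominus_self]

theorem ominus_eq_left_iff {x y : A} : x ⊖ y = x ↔ x ⊖ (x ⊖ y) = 0 :=
  ⟨fun h => by rw [h, ominus_self], fun h => ominus_antisymm (ominus_ominus_left x y) h⟩

/-- The iterated difference `x ⊖ y ⊖ ⋯ ⊖ y` with `k` copies of `y`. -/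
def iter (x y : A) : ℕ → A
  | 0 => x
  | k + 1 => iter x y k ⊖ y

@[simp] theorem iter_zero (x y : A) : iter x y 0 = x := rfl

theorem iter_succ (x y : A) (k : ℕ) : iter x y (k + 1) = iter x y k ⊖ y := rfl

theorem iter_const_zero (x : A) (k : ℕ) : iter x 0 k = x := by
  induction k with
  | zero => rfl
  | succ k ih => rw [iter_succ, ih, BCKAlgebra.ominus_zero]

theorem iter_add (x y : A) (k l : ℕ) : iter x y (k + l) = iter (iter x y k) y l := by
  induction l with
  | zero => rfl
  | succ l ih => rw [← add_assoc, iter_succ, ih, iter_succ]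

theorem iter_ominus (x y z : A) (k : ℕ) : iter (x ⊖ z) y k = iter x y k ⊖ z := by
  induction k with
  | zero => rfl
  | succ k ih => rw [iter_succ, ih, ominus_right_comm, iter_succ]

theorem iter_anti (x y : A) {k l : ℕ} (h : k ≤ l) : iter x y l ⊖ iter x y k = 0 := by
  induction l, h using Nat.le_induction with
  | base => simp
  | succ l _ ih => exact ominus_trans (ominus_ominus_left _ _) ih

theorem iter_ominus_left (x y : A) (k : ℕ) : iter x y k ⊖ x = 0 :=
  iter_anti x y (Nat.zero_le k)

theorem iter_ominus_iter_le (x z y : A) (k : ℕ) :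
    (iter x y k ⊖ iter z y k) ⊖ (x ⊖ z) = 0 := by
  induction k with
  | zero => simp
  | succ k ih => exact ominus_trans (ominus_ominus_ominus_le _ _ y) ih

theorem iter_stable {x y : A} {k : ℕ} (h : iter x y k = iter x y (k + 1)) {l : ℕ} (hl : k ≤ l) :
    iter x y l = iter x y (l + 1) := by
  induction l, hl using Nat.le_induction with
  | base => exact h
  | succ l _ ih => rw [iter_succ, ih, iter_succ, iter_succ, ← iter_succ x y l, ← ih]

/-- Pigeonhole: a decreasing sequence that repeats a value is constant between the two occurrences,
and once stationary stays so. -/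
theorem iter_card_stable [Finite A] (x y : A) {l : ℕ} (hl : Nat.card A ≤ l) :
    iter x y l = iter x y (l + 1) := by
  have : Fintype A := Fintype.ofFinite A
  obtain ⟨i, j, hij, h⟩ := Fintype.exists_ne_map_eq_of_card_lt
    (fun i : Fin (Nat.card A + 1) => iter x y i) (by simp [Nat.card_eq_fintype_card])
  wlog hlt : i < j generalizing i j
  · exact this j i hij.symm h.symm (lt_of_le_of_ne (not_lt.1 hlt) hij.symm)
  have hi : iter x y i = iter x y (i + 1) := by
    refine ominus_antisymm ?_ (iter_anti x y (Nat.le_succ _))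
    have h' : iter x y i = iter x y j := h
    rw [h']
    exact iter_anti x y (Nat.succ_le_of_lt hlt)
  exact iter_stable hi (by omega)

/-- If `x ∧ y = 0` and `t` lies in the ideal generated by `x`, then `t ∧ y = 0`. -/
theorem meet_eq_zero_of_iter {x y : A} (hxy : x ⊖ (x ⊖ y) = 0) :
    ∀ (k : ℕ) (t : A), iter t x k = 0 → t ⊖ (t ⊖ y) = 0 := by
  have step : ∀ t : A, (t ⊖ x) ⊖ ((t ⊖ x) ⊖ y) = 0 → t ⊖ (t ⊖ y) = 0 := by
    intro t h
    -- Since `s ≤ y`, the meet of `s` and `x` vanishes, so `s = s ⊖ x ≤ t ⊖ x`; with `s ≤ y` this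
    -- forces `s = 0`.
    set s := t ⊖ (t ⊖ y) with hs
    have hst : s ⊖ t = 0 := ominus_ominus_left _ _
    have hsy : s ⊖ y = 0 := meet_ominus_right t y
    have hsx : s ⊖ x = s := by
      rw [ominus_eq_left_iff]
      have h1 := le_meet (meet_ominus_right s x)
        (ominus_trans (ominus_ominus_left s (s ⊖ x)) hsy)
      rwa [hxy, BCKAlgebra.ominus_zero] at h1
    have h2 : s ⊖ (t ⊖ x) = 0 := by
      have := ominus_mono hst x
      rwa [hsx] at this
    have h3 := le_meet h2 hsy
    rwa [h, BCKAlgebra.ominus_zero] at h3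
  intro k
  induction k with
  | zero => intro t h; rw [iter_zero] at h; simp [h]
  | succ k ih =>
    intro t h
    refine step t (ih _ ?_)
    rw [iter_ominus]; exact h

end Basic

theorem _root_.IsCBCKHom.map_iter {A B : Type u} [CBCKAlgebra A] [CBCKAlgebra B] {f : A → B}
    (hf : IsCBCKHom f) (x y : A) (k : ℕ) : f (iter x y k) = iter (f x) (f y) k := by
  induction k with
  | zero => rfl
  | succ k ih => rw [iter_succ, hf.map_ominus, ih, iter_succ]

/-! ### Subalgebras -/

section Subalgebra

variable {A : Type u} [CBCKAlgebra A]

/-- The subalgebra on a subset containing `0` and closed under differences. -/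
abbrev subalgebra (S : Set A) (h0 : (0 : A) ∈ S) (h : ∀ x ∈ S, ∀ y ∈ S, x ⊖ y ∈ S) :
    CBCKAlgebra S where
  zero := ⟨0, h0⟩
  ominus x y := ⟨x.1 ⊖ y.1, h _ x.2 _ y.2⟩
  bck_one x y z := Subtype.ext (BCKAlgebra.bck_one x.1 y.1 z.1)
  ominus_zero x := Subtype.ext (BCKAlgebra.ominus_zero x.1)
  zero_ominus x := Subtype.ext (BCKAlgebra.zero_ominus x.1)
  eq_of_ominus x y h k := Subtype.ext
    (BCKAlgebra.eq_of_ominus x.1 y.1 (congrArg Subtype.val h) (congrArg Subtype.val k))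
  comm x y := Subtype.ext (CBCKAlgebra.comm x.1 y.1)

theorem isCBCKHom_subtypeVal (S : Set A) (h0 : (0 : A) ∈ S)
    (h : ∀ x ∈ S, ∀ y ∈ S, x ⊖ y ∈ S) :
    @IsCBCKHom S A (subalgebra S h0 h) _ Subtype.val :=
  letI := subalgebra S h0 h
  ⟨rfl, fun _ _ => rfl⟩

end Subalgebra

/-! ### Ideals, quotients and prime quotients -/

section Ideal

variable {A : Type u} [CBCKAlgebra A]

/-- Ideals of a cBCK-algebra. -/
structure IsIdeal (I : Set A) : Prop where
  zero_mem : (0 : A) ∈ I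
  mem_of_ominus_mem : ∀ {x y : A}, y ∈ I → x ⊖ y ∈ I → x ∈ I

namespace IsIdeal

variable {I : Set A} (hI : IsIdeal I)
include hI

theorem mem_of_le {x y : A} (hy : y ∈ I) (h : x ⊖ y = 0) : x ∈ I :=
  hI.mem_of_ominus_mem hy (h ▸ hI.zero_mem)

theorem ominus_mem_trans {x y z : A} (h : x ⊖ y ∈ I) (k : y ⊖ z ∈ I) : x ⊖ z ∈ I :=
  hI.mem_of_ominus_mem h (hI.mem_of_le k (BCKAlgebra.bck_one x z y))

theorem ominus_ominus_mem {x x' y y' : A} (hx : x ⊖ x' ∈ I) (hy : y' ⊖ y ∈ I) :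
    (x ⊖ y) ⊖ (x' ⊖ y') ∈ I :=
  hI.ominus_mem_trans (y := x' ⊖ y) (hI.mem_of_le hx (ominus_ominus_ominus_le x x' y))
    (hI.mem_of_le hy (BCKAlgebra.bck_one x' y y'))

/-- The congruence of an ideal. -/
abbrev setoid : Setoid A where
  r x y := x ⊖ y ∈ I ∧ y ⊖ x ∈ I
  iseqv :=
    { refl := fun x => by simpa using hI.zero_mem
      symm := fun h => ⟨h.2, h.1⟩
      trans := fun h k => ⟨hI.ominus_mem_trans h.1 k.1, hI.ominus_mem_trans k.2 h.2⟩ }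

/-- The quotient of a cBCK-algebra by an ideal. -/
abbrev quotient : CBCKAlgebra (Quotient hI.setoid) where
  zero := Quotient.mk hI.setoid 0
  ominus := Quotient.map₂ (fun x y => x ⊖ y) fun _ _ hx _ _ hy =>
    ⟨hI.ominus_ominus_mem hx.1 hy.2, hI.ominus_ominus_mem hx.2 hy.1⟩
  bck_one := by
    rintro ⟨x⟩ ⟨y⟩ ⟨z⟩
    exact congrArg (Quotient.mk hI.setoid) (BCKAlgebra.bck_one x y z)
  ominus_zero := by
    rintro ⟨x⟩
    exact congrArg (Quotient.mk hI.setoid) (BCKAlgebra.ominus_zero x)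
  zero_ominus := by
    rintro ⟨x⟩
    exact congrArg (Quotient.mk hI.setoid) (BCKAlgebra.zero_ominus x)
  eq_of_ominus := by
    rintro ⟨x⟩ ⟨y⟩ h k
    refine Quotient.sound ⟨?_, ?_⟩
    · simpa using (Quotient.exact h).1
    · simpa using (Quotient.exact k).1
  comm := by
    rintro ⟨x⟩ ⟨y⟩
    exact congrArg (Quotient.mk hI.setoid) (CBCKAlgebra.comm x y)

theorem isCBCKHom_mk :
    @IsCBCKHom A (Quotient hI.setoid) _ hI.quotient (Quotient.mk hI.setoid) :=
  letI := hI.quotient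
  ⟨rfl, fun _ _ => rfl⟩

theorem mk_eq_zero_iff {x : A} :
    letI := hI.quotient
    Quotient.mk hI.setoid x = 0 ↔ x ∈ I := by
  refine ⟨fun h => ?_, fun h => Quotient.sound ⟨?_, ?_⟩⟩
  · simpa using (Quotient.exact h).1
  · simpa using h
  · simpa using hI.zero_mem

/-- The ideal generated by an ideal and one element. -/
theorem adjoin (x : A) : IsIdeal {t | ∃ k, iter t x k ∈ I} where
  zero_mem := ⟨0, hI.zero_mem⟩
  mem_of_ominus_mem := by
    rintro t s ⟨n, hs⟩ ⟨m, ht⟩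
    refine ⟨m + n, hI.mem_of_ominus_mem hs (hI.mem_of_le ht ?_)⟩
    rw [iter_add, iter_ominus]
    exact iter_ominus_iter_le _ _ _ _

end IsIdeal

/-- A cBCK-algebra in which `0` is meet-irreducible. -/
def IsPrimeAlgebra (A : Type u) [CBCKAlgebra A] : Prop :=
  ∀ x y : A, x ⊖ (x ⊖ y) = 0 → x = 0 ∨ y = 0

/-- A nonzero element survives in some prime quotient. -/
theorem exists_prime_quotient {a : A} (ha : a ≠ 0) :
    ∃ (I : Set A) (hI : IsIdeal I), a ∉ I ∧ @IsPrimeAlgebra _ hI.quotient := by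
  obtain ⟨I, hmax⟩ : ∃ I, Maximal (fun I : Set A => IsIdeal I ∧ a ∉ I) I := by
    refine zorn_subset _ fun c hc hchain => ?_
    rcases c.eq_empty_or_nonempty with rfl | ⟨J, hJ⟩
    · refine ⟨{0}, ⟨⟨rfl, ?_⟩, by simpa using ha⟩, by simp⟩
      rintro x y rfl h
      simpa using h
    · refine ⟨⋃₀ c, ⟨⟨⟨J, hJ, (hc hJ).1.zero_mem⟩, ?_⟩, ?_⟩,
        fun s hs => Set.subset_sUnion_of_mem hs⟩
      · rintro x y ⟨S, hS, hy⟩ ⟨T, hT, hxy⟩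
        rcases hchain.total hS hT with h | h
        · exact ⟨T, hT, (hc hT).1.mem_of_ominus_mem (h hy) hxy⟩
        · exact ⟨S, hS, (hc hS).1.mem_of_ominus_mem hy (h hxy)⟩
      · rintro ⟨S, hS, h⟩
        exact (hc hS).2 h
  have hI := hmax.prop.1
  refine ⟨I, hI, hmax.prop.2, ?_⟩
  -- By maximality, adjoining any `x ∉ I` captures `a`. In the quotient, disjoint nonzero `x`, `y`
  -- would then make `a` disjoint from `y`, and so from itself.
  have key : ∀ x, x ∉ I → ∃ k, iter a x k ∈ I := by
    intro x hx
    by_contra hcon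
    have hsub : I ⊆ {t | ∃ k, iter t x k ∈ I} := fun t ht => ⟨0, ht⟩
    refine hx (hmax.le_of_ge ⟨hI.adjoin x, hcon⟩ hsub ⟨1, ?_⟩)
    simpa [iter_succ] using hI.zero_mem
  let := hI.quotient
  rintro ⟨x⟩ ⟨y⟩ hxy
  change Quotient.mk hI.setoid x ⊖ (Quotient.mk hI.setoid x ⊖ Quotient.mk hI.setoid y) = 0 at hxy
  change Quotient.mk hI.setoid x = 0 ∨ Quotient.mk hI.setoid y = 0
  by_contra! hne
  rw [Ne, Ne, hI.mk_eq_zero_iff, hI.mk_eq_zero_iff] at hne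
  obtain ⟨k, hk⟩ := key x hne.1
  obtain ⟨l, hl⟩ := key y hne.2
  rw [← hI.mk_eq_zero_iff, hI.isCBCKHom_mk.map_iter] at hk hl
  have h1 := meet_eq_zero_of_iter hxy k _ hk
  rw [comm] at h1
  have h2 := meet_eq_zero_of_iter h1 l _ hl
  rw [ominus_self, BCKAlgebra.ominus_zero, hI.mk_eq_zero_iff] at h2
  exact hmax.prop.2 h2

end Ideal

/-! ### Prime algebras: intervals are chains -/

section Prime

variable {A : Type u} [CBCKAlgebra A] (hA : IsPrimeAlgebra A)
include hA

theorem IsPrimeAlgebra.total {x a b : A} (ha : a ⊖ x = 0) (hb : b ⊖ x = 0) :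
    a ⊖ b = 0 ∨ b ⊖ a = 0 :=
  hA _ _ (prelinear ha hb)

/-- A finite nonempty family in an interval of a prime algebra has a least member. -/
theorem IsPrimeAlgebra.exists_least {x : A} (n : ℕ) (d : ℕ → A) (hd : ∀ i, d i ⊖ x = 0) :
    ∃ i ≤ n, ∀ j ≤ n, d i ⊖ d j = 0 := by
  induction n with
  | zero => exact ⟨0, le_rfl, fun j hj => by simp [Nat.le_zero.1 hj]⟩
  | succ n ih =>
    obtain ⟨i, hi, h⟩ := ih
    rcases hA.total (hd i) (hd (n + 1)) with h' | h'
    · refine ⟨i, by omega, fun j hj => ?_⟩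
      rcases Nat.lt_or_ge n j with hj' | hj'
      · rwa [show j = n + 1 by omega]
      · exact h j hj'
    · refine ⟨n + 1, le_rfl, fun j hj => ?_⟩
      rcases Nat.lt_or_ge n j with hj' | hj'
      · rw [show j = n + 1 by omega, ominus_self]
      · exact ominus_trans h' (h j hj')

/-- In a prime algebra satisfying a stabilisation law below `x`, the chain `[0, x]` is finite. -/
theorem IsPrimeAlgebra.finite_interval {x : A} {M : ℕ}
    (hM : ∀ y : A, y ⊖ x = 0 → iter x y M = iter x y (M + 1)) : {t : A | t ⊖ x = 0}.Finite := by
  by_contra hinf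
  have hinf : Infinite {t : A | t ⊖ x = 0} := Set.infinite_coe_iff.2 hinf
  let : LinearOrder {t : A | t ⊖ x = 0} :=
    { le := fun a b => a.1 ⊖ b.1 = 0
      le_refl := fun a => ominus_self a.1
      le_trans := fun _ _ _ => ominus_trans
      le_antisymm := fun _ _ h k => Subtype.ext (ominus_antisymm h k)
      le_total := fun a b => hA.total a.2 b.2
      toDecidableLE := Classical.decRel _ }
  obtain ⟨s, hs⟩ := Infinite.exists_subset_card_eq {t : A | t ⊖ x = 0} (M + 2)
  let e := s.orderEmbOfFin hs
  -- A strict chain of `M + 2` points; `min` only makes the indexing total. Below, `d` is its least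
  -- gap.
  let t : ℕ → A := fun i => (e ⟨min i (M + 1), by omega⟩).1
  have htx : ∀ i, t i ⊖ x = 0 := fun i => (e ⟨min i (M + 1), by omega⟩).2
  have htle : ∀ i, t i ⊖ t (i + 1) = 0 := fun i =>
    e.monotone (show (⟨min i (M + 1), by omega⟩ : Fin (M + 2)) ≤ ⟨min (i + 1) (M + 1), by omega⟩ by
      simp only [Fin.mk_le_mk]; omega)
  have htne : ∀ i ≤ M, t (i + 1) ⊖ t i ≠ 0 := fun i hi h => by
    have h' := e.le_iff_le.1 (show e ⟨min (i + 1) (M + 1), by omega⟩ ≤ e ⟨min i (M + 1), by omega⟩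
      from h)
    simp only [Fin.mk_le_mk] at h'
    omega
  obtain ⟨i, hi, hleast⟩ := hA.exists_least M (fun i => t (i + 1) ⊖ t i)
    fun i => ominus_trans (ominus_ominus_left _ _) (htx (i + 1))
  set d := t (i + 1) ⊖ t i with hd
  have hdx : d ⊖ x = 0 := ominus_trans (ominus_ominus_left _ _) (htx (i + 1))
  -- Each subtraction of `d` descends at most one link, so `iter x d M` still dominates `t 1 ≠ 0`;
  -- stability makes it disjoint from `d`, against primeness.
  have key : ∀ k ≤ M + 1, t (M + 1 - k) ⊖ iter x d k = 0 := by
    intro k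
    induction k with
    | zero => intro _; exact htx _
    | succ k ih =>
      intro hk
      obtain ⟨j, hj⟩ : ∃ j, j + 1 = M + 1 - k := ⟨M - k, by omega⟩
      have h1 := ih (by omega)
      rw [← hj] at h1
      rw [show M + 1 - (k + 1) = j by omega, iter_succ]
      refine ominus_trans ?_ (ominus_mono h1 d)
      have h2 := ominus_anti (t (j + 1)) (hleast j (by omega))
      rwa [meet_eq_of_le (htle j)] at h2
  have hstab := hM d hdx
  rw [iter_succ, eq_comm, ominus_eq_left_iff] at hstab
  rcases hA _ _ hstab with h | h
  · have h1 := key M (by omega)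
    rw [h, BCKAlgebra.ominus_zero, show M + 1 - M = 0 + 1 by omega] at h1
    exact htne 0 (Nat.zero_le _) (by rw [h1, BCKAlgebra.zero_ominus])
  · exact htne i hi h

/-- If the differences `x ⊖ y ⊖ ⋯ ⊖ y` do not stabilise after `M + 1` steps in a prime algebra,
then it contains the multiples `0, y, 2y, …, (M + 1)y`. -/
theorem IsPrimeAlgebra.exists_multiples {x y : A} {M : ℕ} (hyx : y ⊖ x = 0)
    (h : iter x y (M + 1) ≠ iter x y (M + 2)) :
    ∃ w : ℕ → A, w 0 = 0 ∧ w 1 = y ∧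
      ∀ i ≤ M + 1, ∀ j ≤ M + 1, w i ⊖ w j = w (i - j) := by
  have hy : y ⊖ iter x y M = 0 := by
    refine (hA.total hyx (iter_ominus_left x y M)).resolve_right fun h' => h ?_
    rw [iter_succ x y (M + 1), iter_succ, h', BCKAlgebra.zero_ominus]
  -- The descending sequence read upwards, measured from its term of index `M + 1`.
  let w : ℕ → A := fun k => iter x y (M + 1 - k) ⊖ iter x y (M + 1)
  have w0 : w 0 = 0 := ominus_self _
  have w1 : w 1 = y := meet_eq_of_le hy
  have wmono : ∀ i j, i ≤ j → w i ⊖ w j = 0 := fun i j hij =>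
    ominus_mono (iter_anti x y (by omega)) _
  have wsucc : ∀ k, k < M + 1 → w (k + 1) ⊖ y = w k := by
    intro k hk
    change (iter x y (M + 1 - (k + 1)) ⊖ _) ⊖ y = iter x y (M + 1 - k) ⊖ _
    rw [ominus_right_comm, ← iter_succ, show M + 1 - (k + 1) + 1 = M + 1 - k by omega]
  refine ⟨w, w0, w1, fun i => ?_⟩
  induction i with
  | zero => intro _ j _; rw [w0, BCKAlgebra.zero_ominus, Nat.zero_sub, w0]
  | succ i ih =>
    intro hi j hj
    cases j with
    | zero => rw [w0, BCKAlgebra.ominus_zero, Nat.sub_zero]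
    | succ j =>
      rcases Nat.lt_or_ge i j with hij | hij
      · rw [wmono _ _ (by omega), show i + 1 - (j + 1) = 0 by omega, w0]
      · rw [Nat.add_sub_add_right, ← ih (by omega) j (by omega), ← wsucc i (by omega),
          ← wsucc j (by omega)]
        refine (ominus_ominus_cancel ?_ (wmono _ _ (by omega))).symm
        rw [← w1]
        exact wmono _ _ (by omega)

end Prime

end CBCKAlgebra

/-! ### Stabilisation laws, local finiteness and finite witnesses -/

namespace CBCKVariety

open CBCKAlgebra

/-- The variety defined by `x ⊖ (x ∧ y) ⊖ ⋯ ⊖ (x ∧ y)` (`M` times) being stationary. -/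
def stable (M : ℕ) : CBCKVariety.{u} where
  Mem A _ := ∀ x y : A, iter x (x ⊖ (x ⊖ y)) M = iter x (x ⊖ (x ⊖ y)) (M + 1)
  image_mem f hf hs hA := by
    intro x y
    obtain ⟨x, rfl⟩ := hs x
    obtain ⟨y, rfl⟩ := hs y
    simp only [← hf.map_ominus, ← hf.map_iter, hA x y]
  subalgebra_mem f hf hi hB x y := hi <| by
    simp only [hf.map_ominus, hf.map_iter, hB (f x) (f y)]
  pi_mem A _ hA x y := by
    funext i
    have h : ∀ (p q : ∀ i, A i) (k : ℕ), iter p q k i = iter (p i) (q i) k := by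
      intro p q k
      induction k with
      | zero => rfl
      | succ k ih => rw [iter_succ (p i), ← ih]; rfl
    rw [h, h]
    exact hA i (x i) (y i)

theorem exists_le_stable {V : CBCKVariety.{u}} (hV : V.FinitelyGenerated) :
    ∃ N, V ≤ stable N := by
  obtain ⟨n, G, inst, hfin, rfl⟩ := hV
  refine ⟨∑ i, Nat.card (G i), fun A _ hA => hA _ fun i x y => ?_⟩
  have := hfin i
  exact iter_card_stable _ _ (Finset.single_le_sum (f := fun i => Nat.card (G i))
    (fun _ _ => Nat.zero_le _) (Finset.mem_univ i))

/-- Every algebra is a subdirect product of prime algebras, so inclusion of varieties can be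
tested on prime algebras. -/
theorem le_of_prime {V W : CBCKVariety.{u}}
    (h : ∀ (A : Type u) [CBCKAlgebra A], IsPrimeAlgebra A → W.Mem A → V.Mem A) : W ≤ V := by
  intro A _ hA
  choose I hI ha hprime using fun a : {a : A // a ≠ 0} => exists_prime_quotient a.2
  let : ∀ a, CBCKAlgebra (Quotient (hI a).setoid) := fun a => (hI a).quotient
  refine V.subalgebra_mem (B := ∀ a, Quotient (hI a).setoid) (fun x a => Quotient.mk _ x)
    ⟨rfl, fun _ _ => rfl⟩ (fun x y hxy => ?_) (V.pi_mem _ fun a =>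
      h _ (hprime a) (W.image_mem _ (hI a).isCBCKHom_mk Quotient.mk_surjective hA))
  have key : ∀ a, x ⊖ y ∈ I a ∧ y ⊖ x ∈ I a := fun a => Quotient.exact (congrFun hxy a)
  refine ominus_antisymm ?_ ?_
  · by_contra hne
    exact ha ⟨_, hne⟩ (key _).1
  · by_contra hne
    exact ha ⟨_, hne⟩ (key _).2

/-- If every finite subset of `A` is contained in a subalgebra belonging to `V`, then `A`
belongs to `V`: it is a quotient of the algebra of eventually constant tuples. -/
theorem mem_of_finset_subset {V : CBCKVariety.{u}} {A : Type u} [CBCKAlgebra A]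
    (h : ∀ F : Finset A, ∃ (S : Set A) (h0 : (0 : A) ∈ S) (hS : ∀ x ∈ S, ∀ y ∈ S, x ⊖ y ∈ S),
      ↑F ⊆ S ∧ @CBCKVariety.Mem V S (subalgebra S h0 hS)) : V.Mem A := by
  classical
  choose S h0 hS hF hmem using h
  let : ∀ F, CBCKAlgebra (S F) := fun F => subalgebra (S F) (h0 F) (hS F)
  let T : Set (∀ F, S F) := {p | ∃ (a : A) (F₀ : Finset A), ∀ F, F₀ ⊆ F → (p F : A) = a}
  have hT0 : (0 : ∀ F, S F) ∈ T := ⟨0, ∅, fun _ _ => rfl⟩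
  have hT : ∀ p ∈ T, ∀ q ∈ T, p ⊖ q ∈ T := by
    rintro p ⟨a, F₀, hp⟩ q ⟨b, F₁, hq⟩
    refine ⟨a ⊖ b, F₀ ∪ F₁, fun F hF => ?_⟩
    rw [← hp F (Finset.union_subset_left hF), ← hq F (Finset.union_subset_right hF)]
    rfl
  let := subalgebra T hT0 hT
  have hTmem : V.Mem T :=
    V.subalgebra_mem _ (isCBCKHom_subtypeVal T hT0 hT) Subtype.val_injective (V.pi_mem _ hmem)
  choose f F₀ hf using fun p : T => p.2
  have funique : ∀ (p : T) (a : A) (F₁ : Finset A), (∀ F, F₁ ⊆ F → (p.1 F : A) = a) → f p = a :=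
    fun p a F₁ h => by
      rw [← hf p (F₀ p ∪ F₁) Finset.subset_union_left, h _ Finset.subset_union_right]
  refine V.image_mem f ⟨funique _ _ ∅ fun _ _ => rfl, fun p q => ?_⟩ (fun a => ?_) hTmem
  · refine funique _ _ (F₀ p ∪ F₀ q) fun F hF => ?_
    rw [← hf p F (Finset.union_subset_left hF), ← hf q F (Finset.union_subset_right hF)]
    rfl
  · let p : ∀ F, S F := fun F => if h : a ∈ F then ⟨a, hF F h⟩ else 0
    have hp : ∀ F, {a} ⊆ F → (p F : A) = a := fun F h => by
      simp [p, Finset.singleton_subset_iff.1 h]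
    exact ⟨⟨p, a, {a}, hp⟩, funique _ a {a} hp⟩

/-- A variety not contained in a finitely generated one contains a finite algebra outside it. -/
theorem exists_finite_mem_not_mem {V W : CBCKVariety.{u}} (hV : V.FinitelyGenerated)
    (hVW : ¬ W ≤ V) : ∃ (B : Type u) (_ : CBCKAlgebra B), Finite B ∧ W.Mem B ∧ ¬ V.Mem B := by
  obtain ⟨N, hN⟩ := exists_le_stable hV
  classical
  by_contra! hcon
  have sub_mem : ∀ {A : Type u} [CBCKAlgebra A] {S : Set A} (h0 : (0 : A) ∈ S)
      (hS : ∀ x ∈ S, ∀ y ∈ S, x ⊖ y ∈ S), S.Finite → W.Mem A →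
      @CBCKVariety.Mem V S (subalgebra S h0 hS) := fun {A} _ {S} h0 hS hfin hA =>
    letI := subalgebra S h0 hS
    hcon S _ hfin.to_subtype
      (W.subalgebra_mem _ (isCBCKHom_subtypeVal S h0 hS) Subtype.val_injective hA)
  have hW : W ≤ stable (N + 1) := by
    refine le_of_prime fun A _ hprime hA x y => ?_
    by_contra hne
    obtain ⟨w, w0, w1, hw⟩ := hprime.exists_multiples (ominus_ominus_left _ _) hne
    let S : Set A := w '' Set.Iic (N + 1)
    have h0 : (0 : A) ∈ S := ⟨0, Nat.zero_le _, w0⟩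
    have hS : ∀ x ∈ S, ∀ y ∈ S, x ⊖ y ∈ S := by
      rintro _ ⟨i, hi, rfl⟩ _ ⟨j, hj, rfl⟩
      exact ⟨i - j, (Nat.sub_le i j).trans hi, (hw i hi j hj).symm⟩
    let := subalgebra S h0 hS
    have hstable := hN S (sub_mem h0 hS ((Set.finite_Iic _).image w) hA)
      ⟨w (N + 1), N + 1, Set.self_mem_Iic, rfl⟩ ⟨w 1, 1, by simp, rfl⟩
    have hval := @isCBCKHom_subtypeVal A _ S h0 hS
    have hmeet : w (N + 1) ⊖ (w (N + 1) ⊖ w 1) = w 1 := by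
      rw [hw _ le_rfl _ (by omega), hw _ le_rfl _ (by omega)]
      congr 1
      omega
    have hiter : ∀ k ≤ N + 1, iter (w (N + 1)) (w 1) k = w (N + 1 - k) := by
      intro k
      induction k with
      | zero => intro _; rfl
      | succ k ih =>
        intro hk
        rw [iter_succ, ih (by omega), hw _ (by omega) _ (by omega)]
        congr 1
    -- On the chain, steps `N` and `N + 1` down from `w (N + 1)` give `w 1 = y` and `w 0 = 0`, so
    -- stability forces `y = 0`.
    have h := congrArg Subtype.val hstable
    simp only [hval.map_iter, hval.map_ominus, hmeet] at h
    rw [hiter _ (by omega), hiter _ le_rfl, Nat.sub_self, show N + 1 - N = 1 by omega, w0, w1] at h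
    refine hne ?_
    rw [h, iter_const_zero, iter_const_zero]
  refine hVW (le_of_prime fun A _ hprime hA => mem_of_finset_subset fun F => ?_)
  have hfin : ∀ x : A, {t : A | t ⊖ x = 0}.Finite := fun x =>
    hprime.finite_interval fun y hy => by
      have h := hW A hA x y
      rwa [meet_eq_of_le hy] at h
  -- A down-set is closed under differences; inserting `0` covers empty `F`.
  refine ⟨⋃ x ∈ insert 0 F, {t : A | t ⊖ x = 0}, ?_, ?_, ?_, ?_⟩
  · simp
  · simp only [Set.mem_iUnion]
    rintro x ⟨a, ha, hx⟩ y -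
    exact ⟨a, ha, ominus_trans (ominus_ominus_left x y) hx⟩
  · exact fun x hx => Set.mem_biUnion (Finset.mem_insert_of_mem hx) (ominus_self x)
  · exact sub_mem _ _ (Set.Finite.biUnion (Finset.finite_toSet _) fun x _ => hfin x) hA

end CBCKVariety

/-- Every cover `W` of a finitely generated variety `V` of cBCK-algebras (in the lattice of
varieties of cBCK-algebras) is finitely generated. -/
theorem mainTheorem5 (V W : CBCKVariety.{u}) (hV : V.FinitelyGenerated) (hVW : V ⋖ W) :
    W.FinitelyGenerated := by
  obtain ⟨B, instB, hBfin, hBW, hBV⟩ :=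
    CBCKVariety.exists_finite_mem_not_mem hV hVW.lt.not_ge
  obtain ⟨n, G, instG, hGfin, rfl⟩ := hV
  let G' : Fin (n + 1) → Type u := Fin.cases B G
  let instG' : ∀ i, CBCKAlgebra (G' i) := Fin.cases instB instG
  have hG'W : CBCKVariety.generatedBy G' ≤ W := fun A _ hA =>
    hA W (Fin.cases hBW fun i => hVW.le _ fun U hU => hU i)
  have hGG' : CBCKVariety.generatedBy G < CBCKVariety.generatedBy G' := by
    refine lt_of_le_not_ge (fun A _ hA U hU => hA U fun i => hU i.succ) fun h => hBV ?_
    exact h B fun U hU => hU 0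
  refine ⟨n + 1, G', instG', Fin.cases hBfin hGfin, ?_⟩
  exact ((hVW.eq_or_eq hGG'.le hG'W).resolve_left hGG'.ne').symm
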